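/- **Corollary 4.5.** Let $Y\subset\mathbf C^n$ be a complex algebraic variety (respectively, an analytic set near the origin) containing the origin, and let $(Y,y)$, $y=0$, be its germ in the Zariski (respectively, Euclidean) topology; $Y$ may be reducible. Let $I$ be the ideal of all germs at $0$ of regular (respectively, analytic) functions on $\mathbf C^n$ that vanish on $(Y,y)$, and let $\dim Y$ be the dimension of the germ, i.e. the Krull dimension of its local ring (the ring of germs at $0$ of regular, respectively analytic, functions on $\mathbf C^n$ modulo $I$). A *formal jet* of $Y$ at $y$ is an $n$-tuple $\hat j=(\hat j_1,\dots,\hat j_n)$ of power series in $\mathbf C[[t]]$ with $\hat j_i(0)=0$ such that $h\circ\hat j=0$ for every $h\in I$. For $k\ge 0$ let $J^k_y(Y)$ be the set of $k$-jets of $Y$ at $y$, that is, of truncations of formal jets of $Y$ at $y$ modulo $t^{k+1}$, regarded as a subset of the affine space $\mathbf C^{n(k+1)}$ of coefficients. For $1\le m\le k$ let $J^{k,m}_y(Y)\subset J^k_y(Y)$ be the set of $k$-jets of multiplicity $m$, that is, those for which $m$ is the smallest $s$ such that the coefficient of $t^s$ in some component is nonzero. The dimension of a subset of an affine space is the dimension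 of its Zariski closure. Then $$\dim J^{k,m}_y(Y)\le (k-m+1)\dim Y+\min(m-1,\,k-m)\qquad(1\le m\le k),$$ and, in particular, $\dim J^k_y(Y)\le k\dim Y$ for every $k\ge 0$. -/

import Mathlib

open Filter Topology

namespace JetGerm

noncomputable section

/-! ### Jets of curves at the origin of `ℂⁿ` -/

/-- The formal jets `(ĵ₁, …, ĵₙ)` of curves through the origin of `ℂⁿ`:
`n`-tuples of formal power series in `t` without constant term. -/
abbrev FormalCurve (n : ℕ) : Type :=
  {j : Fin n → PowerSeries ℂ // ∀ i, PowerSeries.constantCoeff (j i) = 0}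

/-- The affine space of `k`-jets of curves in `ℂⁿ`. The coordinate `(i, s)` is the coefficient
of `t ^ s` in the `i`-th component. -/
abbrev JetSpace (n k : ℕ) : Type := Fin n × Fin (k + 1) → ℂ

/-- The `k`-jet of a formal curve: forget all coefficients of degree greater than `k`. -/
def truncate {n : ℕ} (k : ℕ) (j : FormalCurve n) : JetSpace n k :=
  fun p => PowerSeries.coeff (p.2 : ℕ) (j.1 p.1)

/-- A `k`-jet has multiplicity `m` if `m` is the smallest `s` such that some component has a
nonzero coefficient (equivalently, a nonzero derivative at `t = 0`) of order `s`. The zero jet has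
no multiplicity. -/
def HasMultiplicity {n k : ℕ} (j : JetSpace n k) (m : ℕ) : Prop :=
  IsLeast {s : ℕ | ∃ (i : Fin n) (r : Fin (k + 1)), (r : ℕ) = s ∧ j (i, r) ≠ 0} m

/-- The dimension of a subset of an affine space `ℂ^σ`: the dimension of its Zariski closure,
that is, the Krull dimension of the coordinate ring of the closure (`⊥` for the empty set). -/
def zariskiDim {σ : Type*} (S : Set (σ → ℂ)) : WithBot ℕ∞ :=
  ringKrullDim (MvPolynomial σ ℂ ⧸ MvPolynomial.vanishingIdeal ℂ S)

/-! ### Germs of algebraic varieties at the origin (Zariski topology) -/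

/-- `Y` is a closed algebraic subset of `ℂⁿ`. -/
def IsAlgebraicSet {n : ℕ} (Y : Set (Fin n → ℂ)) : Prop :=
  ∃ I : Ideal (MvPolynomial (Fin n) ℂ), Y = MvPolynomial.zeroLocus ℂ I

/-- The maximal ideal of the origin in `ℂ[x₁, …, xₙ]`. -/
def originIdeal (n : ℕ) : Ideal (MvPolynomial (Fin n) ℂ) :=
  RingHom.ker (MvPolynomial.constantCoeff (σ := Fin n) (R := ℂ))

instance (n : ℕ) : (originIdeal n).IsPrime := RingHom.ker_isPrime _

/-- The ring of germs at the origin of regular functions on `ℂⁿ`. -/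
abbrev RegularGerm (n : ℕ) : Type := Localization.AtPrime (originIdeal n)

/-- The defining ideal of the germ `(Y, 0)` in the ring of regular germs. -/
def regularIdeal {n : ℕ} (Y : Set (Fin n → ℂ)) : Ideal (RegularGerm n) :=
  (MvPolynomial.vanishingIdeal ℂ Y).map (algebraMap (MvPolynomial (Fin n) ℂ) (RegularGerm n))

/-- The dimension of the germ `(Y, 0)`: the Krull dimension of its local ring. -/
def algGermDim {n : ℕ} (Y : Set (Fin n → ℂ)) : WithBot ℕ∞ :=
  ringKrullDim (RegularGerm n ⧸ regularIdeal Y)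

theorem constantCoeff_aeval {n : ℕ} (j : FormalCurve n) (q : MvPolynomial (Fin n) ℂ) :
    PowerSeries.constantCoeff (MvPolynomial.aeval j.1 q) = MvPolynomial.constantCoeff q := by
  induction q using MvPolynomial.induction_on with
  | C a => simp
  | add p q hp hq => simp [hp, hq]
  | mul_X p i _ => simp [j.2 i]

/-- Composition `h ↦ h ∘ ĵ` of regular germs with a formal curve through the origin. -/
def compRegular {n : ℕ} (j : FormalCurve n) : RegularGerm n →+* PowerSeries ℂ :=
  IsLocalization.lift (M := (originIdeal n).primeCompl)
    (g := (MvPolynomial.aeval (R := ℂ) j.1).toRingHom) (by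
      rintro ⟨q, hq⟩
      refine PowerSeries.isUnit_iff_constantCoeff.2 (isUnit_iff_ne_zero.2 fun h => hq ?_)
      exact RingHom.mem_ker.2 ((constantCoeff_aeval j q).symm.trans h))

/-- The formal jets of the germ `(Y, 0)`: the formal curves `ĵ` such that `h ∘ ĵ = 0` for every
regular germ `h` in the defining ideal. -/
def algFormalJets {n : ℕ} (Y : Set (Fin n → ℂ)) : Set (FormalCurve n) :=
  {j | ∀ h ∈ regularIdeal Y, compRegular j h = 0}

/-! ### Germs of analytic sets at the origin (Euclidean topology) -/

/-- `Y` is, near the origin, the common zero set of finitely many analytic functions. -/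
def IsAnalyticSetGerm {n : ℕ} (Y : Set (Fin n → ℂ)) : Prop :=
  ∃ (r : ℕ) (F : Fin r → (Fin n → ℂ) → ℂ), (∀ i, AnalyticAt ℂ (F i) 0) ∧
    ∀ᶠ x in 𝓝 (0 : Fin n → ℂ), x ∈ Y ↔ ∀ i, F i x = 0

/-- The term of degree `d` of the power series `f` at the point `x`. -/
def term {n : ℕ} (f : MvPowerSeries (Fin n) ℂ) (x : Fin n → ℂ) (d : Fin n →₀ ℕ) : ℂ :=
  MvPowerSeries.coeff d f * ∏ i, x i ^ d i

theorem term_add {n : ℕ} (f g : MvPowerSeries (Fin n) ℂ) (x : Fin n → ℂ) :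
    term (f + g) x = fun d => term f x d + term g x d := by
  funext d
  simp [term, add_mul]

theorem term_mul {n : ℕ} (f g : MvPowerSeries (Fin n) ℂ) (x : Fin n → ℂ) :
    term (f * g) x =
      fun d => ∑ p ∈ Finset.HasAntidiagonal.antidiagonal d, term f x p.1 * term g x p.2 := by
  classical
  funext d
  rw [term, MvPowerSeries.coeff_mul, Finset.sum_mul]
  refine Finset.sum_congr rfl fun p hp => ?_
  rw [← Finset.HasAntidiagonal.mem_antidiagonal.1 hp, term, term]
  simp only [Finsupp.add_apply, pow_add, Finset.prod_mul_distrib]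
  ring

theorem hasSum_term_mul {n : ℕ} {f g : MvPowerSeries (Fin n) ℂ} {x : Fin n → ℂ} {a b : ℂ}
    (hf : HasSum (term f x) a) (hg : HasSum (term g x) b) :
    HasSum (term (f * g) x) (a * b) := by
  have h := summable_mul_of_summable_norm hf.summable.norm hg.summable.norm
  have e := hf.summable.tsum_mul_tsum_eq_tsum_sum_antidiagonal hg.summable h
  rw [hf.tsum_eq, hg.tsum_eq] at e
  rw [term_mul, e]
  exact (summable_sum_mul_antidiagonal_of_summable_mul h).hasSum

theorem hasSum_term_C {n : ℕ} (c : ℂ) (x : Fin n → ℂ) :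
    HasSum (term (MvPowerSeries.C c) x) c := by
  classical
  have h : HasSum (term (MvPowerSeries.C c) x) (term (MvPowerSeries.C c) x 0) :=
    hasSum_single 0 fun d hd => by simp [term, MvPowerSeries.coeff_C, hd]
  simpa [term] using h

/-- The ring `ℂ{x₁, …, xₙ}` of germs at the origin of analytic functions on `ℂⁿ`: the power series
that converge in a neighbourhood of the origin. -/
def ConvergentSeries (n : ℕ) : Subalgebra ℂ (MvPowerSeries (Fin n) ℂ) where
  carrier := {f | ∀ᶠ x in 𝓝 (0 : Fin n → ℂ), Summable (term f x)}
  mul_mem' {f g} hf hg := by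
    filter_upwards [hf, hg] with x hx hx'
    exact (hasSum_term_mul hx.hasSum hx'.hasSum).summable
  add_mem' {f g} hf hg := by
    filter_upwards [hf, hg] with x hx hx'
    rw [term_add]
    exact hx.add hx'
  algebraMap_mem' c := Eventually.of_forall fun x => by
    simpa [MvPowerSeries.algebraMap_apply] using (hasSum_term_C c x).summable

/-- The defining ideal of the germ `(Y, 0)` in `ℂ{x₁, …, xₙ}`: the convergent power series whose
sum vanishes on `Y` near the origin. -/
def analyticIdeal {n : ℕ} (Y : Set (Fin n → ℂ)) : Ideal (ConvergentSeries n) where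
  carrier := {f | ∀ᶠ x in 𝓝 (0 : Fin n → ℂ), x ∈ Y → HasSum (term f.1 x) 0}
  zero_mem' := Eventually.of_forall fun x _ => by
    simpa using hasSum_term_C (0 : ℂ) x
  add_mem' {f g} hf hg := by
    filter_upwards [hf, hg] with x hx hx' hY
    have h := (hx hY).add (hx' hY)
    rw [add_zero] at h
    simpa only [Subalgebra.coe_add, term_add] using h
  smul_mem' f g hg := by
    filter_upwards [f.2, hg] with x hx hx' hY
    simpa using hasSum_term_mul hx.hasSum (hx' hY)

/-- The dimension of the analytic germ `(Y, 0)`: the Krull dimension of its local ring. -/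
def analyticGermDim {n : ℕ} (Y : Set (Fin n → ℂ)) : WithBot ℕ∞ :=
  ringKrullDim (ConvergentSeries n ⧸ analyticIdeal Y)

/-- The formal jets of the analytic germ `(Y, 0)`: the formal curves `ĵ` such that `h ∘ ĵ = 0`
(substitution of `ĵ` in the power series `h`) for every `h` in the defining ideal. -/
def analyticFormalJets {n : ℕ} (Y : Set (Fin n → ℂ)) : Set (FormalCurve n) :=
  {j | ∀ h ∈ analyticIdeal Y, MvPowerSeries.subst j.1 h.1 = (0 : PowerSeries ℂ)}

/-! ### `k`-jets of a germ -/

/-- The `k`-jets of a germ with given set `A` of formal jets: the truncations of the elements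
of `A`. -/
def jets {n : ℕ} (A : Set (FormalCurve n)) (k : ℕ) : Set (JetSpace n k) :=
  truncate k '' A

/-- The `k`-jets of multiplicity `m`. -/
def jetsOfMultiplicity {n : ℕ} (A : Set (FormalCurve n)) (k m : ℕ) : Set (JetSpace n k) :=
  {j ∈ jets A k | HasMultiplicity j m}

end

end JetGerm

/-! The summand `min (m - 1) (k - m)` is never needed: on a germ of dimension `d`, the `k`-jets of
order at least `m` form a set of dimension at most `(k + 1 - m) * d`, and `m = 1` covers all jets.

Noether normalization bounds the dimension of such a set by the number `r` of some polynomials that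
are algebraically independent on it (`exists_zariskiDim_le`). A generic member `j` of the set, over
a field `L ⊇ ℂ`, satisfies all its formal equations and keeps these polynomials independent
(`exists_generic_curve`). Formal Noether normalization (`exists_normalization`) gives `e` linear
forms `y` in the components of `j` such that `ℂ⟦j⟧` is integral over the power series ring `ℂ⟦y⟧`;
going up then yields `e ≤ d` (`natCast_le_ringKrullDim`).

To see `r ≤ (k + 1 - m) * e`, apply derivations of `L` with prescribed values on the `r` independent
elements to the coefficients of `j`. This gives an `r`-dimensional space of vectors over `L⟦t⟧`. By
integrality in characteristic zero, a `t`-linear derivation killing `y` kills `j`, so any `e + 1` of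
these vectors are dependent over `L⟦t⟧`. They start in order `m` and are determined by their
coefficients up to order `k`; counting leading coefficients, at most `e` in each order, gives the
bound (`finrank_le_mul_of_dependent`). -/

/-! ### Extension of derivations in characteristic zero -/

section Derivations

/-- A derivation along a formally étale algebra extends. -/
theorem Derivation.exists_extension_of_formallyEtale {k A L : Type*} [CommRing k] [CommRing A]
    [CommRing L] [Algebra k A] [Algebra k L] [Algebra A L] [IsScalarTower k A L]
    [Algebra.FormallyEtale A L] (d : Derivation k A L) :
    ∃ D : Derivation k L L, ∀ a, D (algebraMap A L a) = d a := by
  -- Differentials of `L` are those of `A` after base change, so the `L`-linear extension of `d`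
  -- transports to them.
  let e := KaehlerDifferential.tensorKaehlerEquivOfFormallyEtale k A L
  let φ : TensorProduct A L (KaehlerDifferential k A) →ₗ[L] L :=
    TensorProduct.AlgebraTensorModule.lift
      ((LinearMap.lsmul L (KaehlerDifferential k A →ₗ[A] L)).flip d.liftKaehlerDifferential)
  refine ⟨(φ ∘ₗ e.symm.toLinearMap).compDer (KaehlerDifferential.D k L), fun a => ?_⟩
  have h := KaehlerDifferential.tensorKaehlerEquivOfFormallyEtale_symm_D_algebraMap k A L a
  change φ (e.symm (KaehlerDifferential.D k L (algebraMap A L a))) = d a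
  rw [show e.symm _ = _ from h]
  simp [φ]

/-- Derivations of a field of characteristic zero can be prescribed on a transcendence basis. -/
theorem IsTranscendenceBasis.exists_derivation {k L ι : Type*} [Field k] [Field L] [CharZero L]
    [Algebra k L] {x : ι → L} (hx : IsTranscendenceBasis k x) (c : ι → L) :
    ∃ D : Derivation k L L, ∀ i, D (x i) = c i := by
  let S := Algebra.adjoin k (Set.range x)
  let F := IntermediateField.adjoin k (Set.range x)
  -- A localization followed by a separable algebraic extension.
  have hSL : Algebra.FormallyEtale S L := by
    open scoped IntermediateField.algebraAdjoinAdjoin in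
    have : Algebra.FormallyEtale S F := .of_isLocalization (nonZeroDivisors _)
    have : Algebra.IsAlgebraic F L := hx.isAlgebraic_field
    have : CharZero F := (algebraMap F L).charZero
    have : Algebra.FormallyEtale F L := Algebra.FormallyEtale.of_isSeparable _ _
    open scoped IntermediateField.algebraAdjoinAdjoin in
    exact .comp S F L
  let e : MvPolynomial ι k ≃ₐ[k] S := hx.1.aevalEquiv
  let : Algebra (MvPolynomial ι k) S := (e : MvPolynomial ι k →+* S).toAlgebra
  let : Algebra (MvPolynomial ι k) L := (MvPolynomial.aeval x).toAlgebra
  have : IsScalarTower (MvPolynomial ι k) S L := .of_algebraMap_eq' (by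
    ext <;> simp [RingHom.algebraMap_toAlgebra, e, S])
  have : IsScalarTower k (MvPolynomial ι k) L := .of_algebraMap_eq' (by
    ext; simp [RingHom.algebraMap_toAlgebra])
  have : Algebra.FormallyEtale (MvPolynomial ι k) S :=
    .of_equiv (AlgEquiv.ofBijective (Algebra.ofId (MvPolynomial ι k) S) e.bijective)
  have : Algebra.FormallyEtale (MvPolynomial ι k) L := .comp _ S _
  obtain ⟨D, hD⟩ := (MvPolynomial.mkDerivation k c).exists_extension_of_formallyEtale (L := L)
  refine ⟨D, fun i => ?_⟩
  simpa [RingHom.algebraMap_toAlgebra] using hD (MvPolynomial.X i)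

/-- Derivations of a field of characteristic zero can be prescribed on algebraically independent
elements. -/
theorem AlgebraicIndependent.exists_derivation {k L ι : Type*} [Field k] [Field L] [CharZero L]
    [Algebra k L] {x : ι → L} (hx : AlgebraicIndependent k x) (c : ι → L) :
    ∃ D : Derivation k L L, ∀ i, D (x i) = c i := by
  classical
  obtain ⟨t, hxt, ht⟩ := exists_isTranscendenceBasis_superset hx.to_subtype_range
  -- The value 0 on the added basis elements is arbitrary.
  obtain ⟨D, hD⟩ := ht.exists_derivation fun s => if h : ∃ i, x i = s then c h.choose else 0
  refine ⟨D, fun i => ?_⟩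
  have h : ∃ l, x l = x i := ⟨i, rfl⟩
  rw [hD ⟨x i, hxt ⟨i, rfl⟩⟩, dif_pos h, hx.injective h.choose_spec]

theorem Derivation.sum_apply {k A M ι : Type*} [CommSemiring k] [CommSemiring A] [AddCommMonoid M]
    [Algebra k A] [Module A M] [Module k M] (s : Finset ι) (D : ι → Derivation k A M) (a : A) :
    (∑ i ∈ s, D i) a = ∑ i ∈ s, D i a := by
  rw [← Derivation.coeFnAddMonoidHom_apply, map_sum, Finset.sum_apply]
  rfl

open PowerSeries in
/-- The coefficientwise extension of a derivation to power series. -/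
noncomputable def Derivation.mapPowerSeries {k L : Type*} [CommRing k] [CommRing L] [Algebra k L]
    (D : Derivation k L L) : Derivation k (PowerSeries L) (PowerSeries L) :=
  Derivation.mk'
    { toFun := fun f => PowerSeries.mk fun s => D (coeff s f)
      map_add' := fun f g => by ext; simp
      map_smul' := fun c f => by ext; simp }
    fun f g => by
      ext s
      simp [coeff_mul, Finset.sum_add_distrib]
      rw [← Finset.Nat.sum_antidiagonal_swap (f := fun p => coeff p.1 g * D (coeff p.2 f))]
      simp

@[simp]
theorem Derivation.coeff_mapPowerSeries {k L : Type*} [CommRing k] [CommRing L] [Algebra k L]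
    (D : Derivation k L L) (f : PowerSeries L) (s : ℕ) :
    PowerSeries.coeff s (D.mapPowerSeries f) = D (PowerSeries.coeff s f) := by
  simp [Derivation.mapPowerSeries]

theorem Derivation.mapPowerSeries_X {k L : Type*} [CommRing k] [CommRing L] [Algebra k L]
    (D : Derivation k L L) : D.mapPowerSeries PowerSeries.X = 0 := by
  ext s
  simp [PowerSeries.coeff_X, apply_ite D]

/-- A derivation of a domain of characteristic zero that vanishes on a subring vanishes on the
elements that are integral over it. -/
theorem Derivation.eq_zero_of_isIntegralElem {k A B : Type*} [CommRing k] [CommRing A] [CommRing B]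
    [IsDomain B] [CharZero B] [Algebra k B] (D : Derivation k B B) (φ : A →+* B)
    (h : ∀ a, D (φ a) = 0) {b : B} (hb : φ.IsIntegralElem b) : D b = 0 := by
  let D' : Derivation φ.range B B := Derivation.mk'
    { toFun := D
      map_add' := map_add D
      map_smul' := by
        rintro ⟨_, a, rfl⟩ x
        simp [Subring.smul_def, h] } fun x y => D.leibniz x y
  -- Differentiating `p(b) = 0` gives `p'(b) * D b = 0`. If `p'(b) = 0`, descend to `p'`, which is
  -- nonzero in characteristic zero; no minimal polynomial is needed.
  have key : ∀ (d : ℕ) (p : Polynomial φ.range), p ≠ 0 → p.natDegree = d →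
      Polynomial.aeval b p = 0 → D b = 0 := by
    intro d
    induction d using Nat.strong_induction_on with
    | _ d ih =>
      intro p hp hd hpb
      have hD : Polynomial.aeval b (Polynomial.derivative p) * D b = 0 := by
        have := D'.map_aeval p b
        rw [hpb, map_zero] at this
        exact this.symm
      rcases mul_eq_zero.1 hD with h0 | h0
      · have hd0 : p.natDegree ≠ 0 := by
          intro h1
          rw [Polynomial.eq_C_of_natDegree_eq_zero h1, Polynomial.aeval_C] at hpb
          have h2 : p.coeff 0 = 0 := Subtype.ext hpb
          exact hp (by rw [Polynomial.eq_C_of_natDegree_eq_zero h1, h2, Polynomial.C_0])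
        exact ih _ (hd ▸ Polynomial.natDegree_derivative_lt hd0) _
          (fun h1 => hd0 (Polynomial.derivative_eq_zero.1 h1)) rfl h0
      · exact h0
  obtain ⟨p, hp, hpb⟩ := hb
  refine key _ (p.map φ.rangeRestrict) (hp.map _).ne_zero rfl ?_
  rw [Polynomial.aeval_def, Polynomial.eval₂_map]
  exact hpb

end Derivations

/-! ### Substitution of curves into power series -/

section Substitution

open PowerSeries

variable {k : Type*} [CommRing k] {S : Type*} [CommRing S] [Algebra k S]

theorem PowerSeries.hasSubst_pi {σ : Type*} [Finite σ] {a : σ → PowerSeries S}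
    (ha : ∀ i, constantCoeff (a i) = 0) : MvPowerSeries.HasSubst a :=
  MvPowerSeries.hasSubst_of_constantCoeff_zero ha

/-- A family of power series in one variable that vanish at zero defines a homomorphism
by substitution. -/
noncomputable def PowerSeries.substPi (k : Type*) [CommRing k] [Algebra k S] {σ : Type*} [Finite σ]
    (a : σ → PowerSeries S) (ha : ∀ i, constantCoeff (a i) = 0) :
    MvPowerSeries σ k →ₐ[k] PowerSeries S :=
  MvPowerSeries.substAlgHom (hasSubst_pi ha)

theorem PowerSeries.substPi_apply {σ : Type*} [Finite σ]
    (a : σ → PowerSeries S) (ha : ∀ i, constantCoeff (a i) = 0) (f : MvPowerSeries σ k) :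
    substPi k a ha f = MvPowerSeries.subst a f :=
  MvPowerSeries.substAlgHom_apply _ f

@[simp]
theorem PowerSeries.substPi_X {σ : Type*} [Finite σ]
    (a : σ → PowerSeries S) (ha : ∀ i, constantCoeff (a i) = 0) (i : σ) :
    substPi k a ha (MvPowerSeries.X i) = a i :=
  MvPowerSeries.substAlgHom_X _ i

@[simp]
theorem PowerSeries.substPi_coe {σ : Type*} [Finite σ]
    (a : σ → PowerSeries S) (ha : ∀ i, constantCoeff (a i) = 0) (p : MvPolynomial σ k) :
    substPi k a ha p = MvPolynomial.aeval a p :=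
  MvPowerSeries.substAlgHom_coe _ p

theorem PowerSeries.coeff_substPi {σ : Type*} [Finite σ]
    (a : σ → PowerSeries S) (ha : ∀ i, constantCoeff (a i) = 0) (f : MvPowerSeries σ k) (s : ℕ) :
    coeff s (substPi k a ha f) =
      ∑ᶠ d : σ →₀ ℕ, MvPowerSeries.coeff d f • coeff s (d.prod fun i e => a i ^ e) := by
  rw [substPi_apply]
  exact MvPowerSeries.coeff_subst (hasSubst_pi ha) f (Finsupp.single () s)

theorem PowerSeries.coeff_substPi_finite {σ : Type*} [Finite σ]
    (a : σ → PowerSeries S) (ha : ∀ i, constantCoeff (a i) = 0) (f : MvPowerSeries σ k) (s : ℕ) :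
    (fun d : σ →₀ ℕ =>
      MvPowerSeries.coeff d f • coeff s (d.prod fun i e => a i ^ e)).HasFiniteSupport :=
  MvPowerSeries.coeff_subst_finite (hasSubst_pi ha) f (Finsupp.single () s)

theorem PowerSeries.map_substPi {T : Type*} [CommRing T] [Algebra k T] (φ : S →ₐ[k] T)
    {σ : Type*} [Finite σ] (a : σ → PowerSeries S) (ha : ∀ i, constantCoeff (a i) = 0)
    (ha' : ∀ i, constantCoeff (PowerSeries.map (φ : S →+* T) (a i)) = 0)
    (f : MvPowerSeries σ k) :
    PowerSeries.map (φ : S →+* T) (substPi k a ha f) =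
      substPi k (fun i => PowerSeries.map (φ : S →+* T) (a i)) ha' f := by
  ext s
  rw [coeff_map, coeff_substPi, coeff_substPi]
  have := (φ : S →+ T).map_finsum (coeff_substPi_finite a ha f s)
  refine this.trans (finsum_congr fun d => ?_)
  rw [show d.prod (fun i e => PowerSeries.map (φ : S →+* T) (a i) ^ e) =
    PowerSeries.map (φ : S →+* T) (d.prod fun i e => a i ^ e) by simp [Finsupp.prod]]
  simp

/-- Each `a i` is divisible by `X`, so a monomial of degree `d` contributes a multiple of `X ^ d`.
This allows replacing `f` by a polynomial modulo `X ^ N`. -/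
theorem PowerSeries.X_pow_dvd_substPi {σ : Type*} [Finite σ] (a : σ → PowerSeries S)
    (ha : ∀ i, constantCoeff (a i) = 0) (f : MvPowerSeries σ k) (N : ℕ)
    (hf : ∀ d : σ →₀ ℕ, d.degree < N → MvPowerSeries.coeff d f = 0) :
    X ^ N ∣ substPi k a ha f := by
  rw [X_pow_dvd_iff]
  intro s hs
  rw [coeff_substPi]
  refine finsum_eq_zero_of_forall_eq_zero fun d => ?_
  by_cases hd : d.degree < N
  · rw [hf d hd, zero_smul]
  · have hdvd : X ^ d.degree ∣ d.prod fun i e => a i ^ e := by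
      rw [Finsupp.degree_apply, ← Finset.prod_pow_eq_pow_sum]
      exact Finset.prod_dvd_prod_of_dvd _ _ fun i _ => pow_dvd_pow_of_dvd (X_dvd_iff.2 (ha i)) _
    rw [X_pow_dvd_iff.1 hdvd s (by omega), smul_zero]

/-- A `t`-linear derivation that kills a family of power series kills every power series in this
family. -/
theorem Derivation.substPi_eq_zero {σ : Type*} [Finite σ] (D : Derivation k (PowerSeries S)
    (PowerSeries S)) (hX : D X = 0) (a : σ → PowerSeries S) (ha : ∀ i, constantCoeff (a i) = 0)
    (hD : ∀ i, D (a i) = 0) (f : MvPowerSeries σ k) : D (substPi k a ha f) = 0 := by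
  classical
  cases nonempty_fintype σ
  ext s
  -- No continuity of `D` is assumed: since `D X = 0`, the image of a multiple of `X ^ (s + 1)` is
  -- again one, invisible in degree `s`.
  have hsplit : X ^ (s + 1) ∣ substPi k a ha f -
      MvPolynomial.aeval a (MvPowerSeries.truncTotal (s + 1) f) := by
    rw [← substPi_coe a ha, ← map_sub]
    refine X_pow_dvd_substPi a ha _ _ fun d hd => ?_
    simp [MvPowerSeries.coeff_truncTotal f hd]
  obtain ⟨g, hg⟩ := hsplit
  have hpoly : D (MvPolynomial.aeval a (MvPowerSeries.truncTotal (s + 1) f)) = 0 := by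
    induction (MvPowerSeries.truncTotal (s + 1) f) using MvPolynomial.induction_on with
    | C c => simp
    | add p q hp hq => simp [hp, hq]
    | mul_X p i hp => simp [hp, hD]
  rw [sub_eq_iff_eq_add.1 hg, map_add, hpoly, add_zero, D.leibniz, D.leibniz_pow, hX]
  simp [PowerSeries.coeff_X_pow_mul']

end Substitution

/-! ### Counting leading coefficients -/

section Counting

open PowerSeries Module

/-- A linear family of tuples of power series of order at least `p`, any `e + 1` of which are
dependent over the power series, and whose members are determined by the `q` coefficients from
order `p` on, has dimension at most `q * e`. -/
theorem finrank_le_mul_of_dependent {L W σ : Type*} [Field L] [AddCommGroup W] [Module L W]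
    [FiniteDimensional L W] [Finite σ] (Φ : W →ₗ[L] σ → PowerSeries L) (e p q : ℕ)
    (hp : ∀ c i s, s < p → coeff s (Φ c i) = 0)
    (hq : ∀ c, (∀ i s, s < p + q → coeff s (Φ c i) = 0) → c = 0)
    (hdep : ∀ c : Fin (e + 1) → W, ∃ g : Fin (e + 1) → PowerSeries L, g ≠ 0 ∧
      ∀ i, ∑ l, g l * Φ (c l) i = 0) :
    finrank L W ≤ q * e := by
  induction q generalizing W p with
  | zero =>
    have : Subsingleton W := subsingleton_of_forall_eq 0 fun c => hq c fun i s hs => hp c i s hs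
    simp [finrank_zero_of_subsingleton]
  | succ q ih =>
    -- The kernel consists of members of order at least `p + 1`, to which induction applies; the
    -- range has dimension at most `e`.
    let lead : W →ₗ[L] σ → L := LinearMap.pi fun i =>
      (PowerSeries.coeff p).comp ((LinearMap.proj i).comp Φ)
    have hker := ih (W := LinearMap.ker lead) (Φ ∘ₗ (LinearMap.ker lead).subtype) (p + 1)
      (by
        rintro ⟨c, hc⟩ i s hs
        rcases Nat.lt_succ_iff_lt_or_eq.1 hs with h | rfl
        · exact hp c i s h
        · exact congrFun hc i)
      (by
        rintro ⟨c, hc⟩ h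
        refine Subtype.ext (hq c fun i s hs => h i s (by omega)))
      (fun c => hdep fun l => c l)
    have hrange : finrank L (LinearMap.range lead) ≤ e := by
      by_contra! hlt
      obtain ⟨v, hv⟩ := exists_linearIndependent_of_le_finrank (R := L)
        (M := LinearMap.range lead) (n := e + 1) hlt
      choose c hc using fun l => (v l).2
      obtain ⟨g, hg0, hg⟩ := hdep c
      -- Cancelling `X ^ N` from the relation and taking its coefficient in order `p` gives a
      -- relation among the independent leading vectors, so every `g l` gains another factor `X`.
      have key : ∀ N l, X ^ N ∣ g l := by
        intro N
        induction N with
        | zero => simp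
        | succ N ihN =>
          choose g' hg' using ihN
          have h0 : ∑ l, constantCoeff (g' l) • v l = 0 := by
            refine Subtype.ext (funext fun i => ?_)
            have h1 : ∑ l, g' l * Φ (c l) i = 0 := by
              have := hg i
              simp only [hg', mul_assoc, ← Finset.mul_sum] at this
              exact (mul_eq_zero.1 this).resolve_left (pow_ne_zero _ X_ne_zero)
            have h2 := congrArg (coeff p) h1
            simp only [map_sum, map_zero] at h2
            simp only [AddSubmonoidClass.coe_finsetSum, Finset.sum_apply, Submodule.coe_smul,
              Pi.smul_apply, smul_eq_mul, ZeroMemClass.coe_zero, Pi.zero_apply, ← h2, ← hc]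
            refine Finset.sum_congr rfl fun l _ => ?_
            obtain ⟨u, hu⟩ := X_pow_dvd_iff.2 (hp (c l) i)
            simp [lead, hu, mul_left_comm (g' l), PowerSeries.coeff_X_pow_mul']
          have h3 := Fintype.linearIndependent_iff.1 hv _ h0
          intro l
          rw [hg' l, pow_succ]
          exact mul_dvd_mul_left _ (X_dvd_iff.2 (h3 l))
      refine hg0 (funext fun l => PowerSeries.ext fun s => ?_)
      exact X_pow_dvd_iff.1 (key (s + 1) l) s (Nat.lt_succ_self s)
    have := LinearMap.finrank_range_add_finrank_ker lead
    rw [Nat.succ_mul]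
    omega

end Counting

/-! ### Weierstrass division and formal Noether normalization -/

section Normalization

open PowerSeries

variable {k : Type*} [Field k]

theorem MvPolynomial.IsHomogeneous.aeval_algebraMap_mul {S σ : Type*} [Fintype σ] [CommRing S]
    [Algebra k S] {P : MvPolynomial σ k} {d : ℕ} (hP : P.IsHomogeneous d) (b : σ → k) (x : S) :
    MvPolynomial.aeval (fun i => algebraMap k S (b i) * x) P =
      algebraMap k S (MvPolynomial.eval b P) * x ^ d := by
  rw [MvPolynomial.aeval_def, MvPolynomial.eval₂_eq', MvPolynomial.eval_eq', map_sum,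
    Finset.sum_mul]
  refine Finset.sum_congr rfl fun e he => ?_
  have hdeg : ∑ i, e i = d := by
    rw [← Finsupp.degree_eq_sum]
    exact (Finsupp.degree_eq_weight_one (R := ℕ) ▸ hP (MvPolynomial.mem_support_iff.1 he))
  simp only [mul_pow, Finset.prod_mul_distrib, map_mul, map_prod, map_pow]
  rw [Finset.prod_pow_eq_pow_sum, hdeg, mul_assoc]

theorem PowerSeries.substPi_subst {S : Type*} [CommRing S] [Algebra k S] {σ τ : Type*} [Finite σ]
    [Finite τ] (a : τ → PowerSeries S) (ha : ∀ i, constantCoeff (a i) = 0)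
    (l : σ → MvPowerSeries τ k) (hl : ∀ i, MvPowerSeries.constantCoeff (l i) = 0)
    (b : σ → PowerSeries S) (hb : ∀ i, constantCoeff (b i) = 0)
    (h : ∀ i, substPi k a ha (l i) = b i) (f : MvPowerSeries σ k) :
    substPi k a ha (MvPowerSeries.subst l f) = substPi k b hb f := by
  simp only [substPi_apply] at h ⊢
  rw [MvPowerSeries.subst_comp_subst_apply (MvPowerSeries.hasSubst_of_constantCoeff_zero hl)
    (hasSubst_pi ha)]
  simp only [h]

/-- A nonzero power series does not vanish on a general line through the origin. -/
theorem MvPowerSeries.exists_substPi_line_ne_zero [Infinite k] {n : ℕ}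
    {f : MvPowerSeries (Fin (n + 1)) k} (hf : f ≠ 0) :
    ∃ b : Fin (n + 1) → k, b 0 = 1 ∧
      substPi k (fun i => PowerSeries.C (b i) * PowerSeries.X) (by simp) f ≠ 0 := by
  classical
  have hex : ∃ d, ∃ e : Fin (n + 1) →₀ ℕ, e.degree = d ∧ coeff e f ≠ 0 := by
    obtain ⟨e, he⟩ := not_forall.1 fun h => hf (MvPowerSeries.ext h)
    exact ⟨_, e, rfl, he⟩
  obtain ⟨e, hed, he⟩ := Nat.find_spec hex
  set d := Nat.find hex
  have hmin : ∀ e' : Fin (n + 1) →₀ ℕ, e'.degree < d → coeff e' f = 0 := fun e' h => by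
    by_contra h0
    exact Nat.find_min hex h ⟨e', rfl, h0⟩
  -- The initial form of `f`, as all terms of degree below `d` vanish.
  set P : MvPolynomial (Fin (n + 1)) k := truncTotal (d + 1) f
  have hPh : P.IsHomogeneous d := by
    intro e' he'
    rw [MvPowerSeries.coeff_truncTotal_eq_ite] at he'
    change Finsupp.weight (fun _ => 1) e' = d
    rw [← Finsupp.degree_eq_weight_one]
    by_contra hne
    split_ifs at he' with h
    · exact he' (hmin e' (lt_of_le_of_ne (Nat.lt_succ_iff.1 h) hne))
    · exact he' rfl
  have hP0 : P ≠ 0 := by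
    intro h0
    refine he ?_
    rw [← MvPowerSeries.coeff_truncTotal f (show e.degree < d + 1 by omega)]
    change MvPolynomial.coeff e P = 0
    rw [h0, MvPolynomial.coeff_zero]
  -- The factor `X 0` forces `r 0 ≠ 0`, so that `r` can be rescaled to first coordinate 1.
  obtain ⟨r, hr⟩ : ∃ r, MvPolynomial.eval r (MvPolynomial.X 0 * P) ≠ 0 := by
    by_contra! h
    exact mul_ne_zero (MvPolynomial.X_ne_zero 0) hP0 (MvPolynomial.funext fun r => by simp [h r])
  rw [map_mul, MvPolynomial.eval_X] at hr
  have hr0 := left_ne_zero_of_mul hr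
  refine ⟨fun i => r i / r 0, div_self hr0, fun h0 => ?_⟩
  have h1 := hPh.aeval_algebraMap_mul (fun i => r i / r 0) (r 0)
  have h2 := hPh.aeval_algebraMap_mul (fun i => r i / r 0) (PowerSeries.X : PowerSeries k)
  simp only [Algebra.algebraMap_self, RingHom.id_apply, div_mul_cancel₀ _ hr0] at h1
  change MvPolynomial.eval r P = _ at h1
  have h3 := X_pow_dvd_substPi (fun i => PowerSeries.C (r i / r 0) * PowerSeries.X)
    (by simp) (f - (P : MvPowerSeries (Fin (n + 1)) k)) (d + 1) fun e' he' => by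
      simp [P, MvPowerSeries.coeff_truncTotal f he']
  rw [map_sub, h0, zero_sub, dvd_neg, substPi_coe] at h3
  have h4 := PowerSeries.X_pow_dvd_iff.1 h3 d (Nat.lt_succ_self d)
  change PowerSeries.coeff d (MvPolynomial.aeval
    (fun i => algebraMap k (PowerSeries k) (r i / r 0) * PowerSeries.X) P) = 0 at h4
  rw [h2] at h4
  refine right_ne_zero_of_mul hr ?_
  rw [h1]
  have h5 : MvPolynomial.eval (fun i => r i / r 0) P = 0 := by
    simpa [PowerSeries.algebraMap_apply, PowerSeries.coeff_X_pow] using h4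
  rw [h5, zero_mul]

/-- Identifies the ideal for which adic completeness is known with the one used in Weierstrass
division. -/
theorem MvPowerSeries.span_range_X_eq_maximalIdeal (σ : Type*) [Finite σ] :
    Ideal.span (Set.range (X : σ → MvPowerSeries σ k)) =
      IsLocalRing.maximalIdeal (MvPowerSeries σ k) := by
  classical
  cases nonempty_fintype σ
  have hmem : ∀ f : MvPowerSeries σ k,
      f ∈ IsLocalRing.maximalIdeal (MvPowerSeries σ k) ↔ constantCoeff f = 0 := fun f => by
    rw [IsLocalRing.mem_maximalIdeal, mem_nonunits_iff, MvPowerSeries.isUnit_iff_constantCoeff,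
      isUnit_iff_ne_zero, not_not]
  refine le_antisymm (Ideal.span_le.2 ?_) fun f hf => ?_
  · rintro _ ⟨i, rfl⟩
    exact (hmem _).2 (by simp)
  -- Monomials involving `X i` are removed one variable at a time; each removal subtracts a multiple
  -- of `X i`.
  have key : ∀ s : Finset σ, ∃ r : MvPowerSeries σ k,
      f - r ∈ Ideal.span (Set.range (X : σ → MvPowerSeries σ k)) ∧
        (∀ e, (∃ i ∈ s, e i ≠ 0) → coeff e r = 0) ∧ coeff 0 r = 0 := by
    intro s
    induction s using Finset.induction_on with
    | empty => exact ⟨f, by simp, by simp, (hmem f).1 hf⟩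
    | insert i s _ ih =>
      obtain ⟨r, hr, hrs, hr0⟩ := ih
      let r' : MvPowerSeries σ k := fun e => if e i = 0 then coeff e r else 0
      have hr' : ∀ e, coeff e r' = if e i = 0 then coeff e r else 0 := fun e => rfl
      refine ⟨r', ?_, ?_, ?_⟩
      · have hdvd : X i ∣ r - r' := X_dvd_iff.2 fun e he => by simp [hr', he]
        rw [← sub_add_sub_cancel f r r']
        exact Ideal.add_mem _ hr (Ideal.mem_of_dvd _ hdvd (Ideal.subset_span ⟨i, rfl⟩))
      · rintro e ⟨l, hl, hel⟩
        rw [hr']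
        rcases Finset.mem_insert.1 hl with rfl | hl
        · exact if_neg hel
        · rw [hrs e ⟨l, hl, hel⟩, ite_self]
      · rw [hr', hr0, ite_self]
  obtain ⟨r, hr, hrs, hr0⟩ := key Finset.univ
  have : r = 0 := by
    ext e
    by_cases he : e = 0
    · rw [he, hr0, map_zero]
    · obtain ⟨i, hi⟩ := Finsupp.ne_iff.1 he
      exact hrs e ⟨i, Finset.mem_univ i, hi⟩
  rwa [this, sub_zero] at hr

/-- Restriction to the first axis is reduction of the coefficients modulo the maximal ideal;
nonvanishing there is thus Weierstrass regularity. -/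
theorem PowerSeries.coeff_substPi_cons_X_zero {n : ℕ} (G : MvPowerSeries (Fin (n + 1)) k)
    (s : ℕ) :
    coeff s (substPi k (Fin.cons X (fun _ => 0) : Fin (n + 1) → PowerSeries k)
      (Fin.cases (by simp) (by simp)) G) =
      MvPowerSeries.constantCoeff (coeff s (MvPowerSeries.finSuccEquiv k n G)) := by
  classical
  rw [coeff_substPi, ← MvPowerSeries.coeff_zero_eq_constantCoeff_apply,
    MvPowerSeries.coeff_coeff_finSuccEquiv, finsum_eq_single _ (Finsupp.cons s 0)]
  · simp [Finsupp.prod_fintype, Fin.prod_univ_succ]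
  · intro e he
    rw [Finsupp.prod_fintype _ _ (by simp), Fin.prod_univ_succ]
    simp only [Fin.cons_zero, Fin.cons_succ]
    by_cases h : ∃ i : Fin n, e i.succ ≠ 0
    · obtain ⟨i, hi⟩ := h
      rw [Finset.prod_eq_zero (Finset.mem_univ i) (zero_pow hi)]
      simp
    · push Not at h
      have hs : s ≠ e 0 := by
        rintro rfl
        refine he (Finsupp.ext fun i => ?_)
        cases i using Fin.cases <;> simp [h]
      simp [h, coeff_X_pow, hs]

variable {L : Type*} [Field L] [Algebra k L]

theorem PowerSeries.substPi_finSuccEquiv_symm_C {n : ℕ} (z : PowerSeries L)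
    (hz : constantCoeff z = 0) (y : Fin n → PowerSeries L) (hy : ∀ i, constantCoeff (y i) = 0)
    (g : MvPowerSeries (Fin n) k) :
    substPi k (Fin.cons z y) (Fin.cases (by simpa) (by simpa))
      ((MvPowerSeries.finSuccEquiv k n).symm (C g)) = substPi k y hy g := by
  have : (MvPowerSeries.finSuccEquiv k n).symm (C g) =
      MvPowerSeries.subst (fun i : Fin n => (MvPowerSeries.X i.succ : MvPowerSeries _ k)) g := by
    have hren : MvPowerSeries.subst
        (fun i : Fin n => (MvPowerSeries.X i.succ : MvPowerSeries _ k)) g =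
        MvPowerSeries.rename (Fin.succEmb n) g := (MvPowerSeries.rename_eq_subst _ _).symm
    rw [AlgEquiv.symm_apply_eq, hren]
    ext s e
    rw [MvPowerSeries.coeff_coeff_finSuccEquiv, coeff_C]
    split_ifs with hs
    · have : e.cons s = e.embDomain (Fin.succEmb n) := by
        subst hs
        ext i
        cases i using Fin.cases with
        | zero => simp [Finsupp.embDomain_of_notMem_range]
        | succ i => simpa using (Finsupp.embDomain_apply_self (Fin.succEmb n) e i).symm
      rw [this, MvPowerSeries.coeff_embDomain_rename]
    · rw [map_zero]
      refine (MvPowerSeries.coeff_rename_eq_zero (Fin.succEmb n) g ?_).symm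
      rintro ⟨x, hx⟩
      refine hs ?_
      have h0 := DFunLike.congr_fun hx 0
      rw [← Finsupp.embDomain_eq_mapDomain,
        Finsupp.embDomain_of_notMem_range _ _ _ (by simp), Finsupp.cons_zero] at h0
      exact h0.symm
  rw [this]
  exact substPi_subst _ _ _ (by simp) _ _ (by simp) _

theorem PowerSeries.substPi_finSuccEquiv_symm_coe {n : ℕ} (z : PowerSeries L)
    (hz : constantCoeff z = 0) (y : Fin n → PowerSeries L) (hy : ∀ i, constantCoeff (y i) = 0)
    (r : Polynomial (MvPowerSeries (Fin n) k)) :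
    substPi k (Fin.cons z y) (Fin.cases (by simpa) (by simpa))
      ((MvPowerSeries.finSuccEquiv k n).symm r) =
      r.eval₂ (substPi k y hy : MvPowerSeries (Fin n) k →+* PowerSeries L) z := by
  induction r using Polynomial.induction_on' with
  | add p q hp hq => simp [hp, hq, Polynomial.eval₂_add]
  | monomial d g =>
    have hX : (MvPowerSeries.finSuccEquiv k n).symm X = MvPowerSeries.X 0 := by
      rw [AlgEquiv.symm_apply_eq, MvPowerSeries.finSuccEquiv_X_zero]
    rw [← Polynomial.C_mul_X_pow_eq_monomial, Polynomial.coe_mul, Polynomial.coe_C,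
      Polynomial.coe_pow, Polynomial.coe_X, map_mul, map_pow, hX, map_mul, map_pow,
      substPi_finSuccEquiv_symm_C z hz y hy]
    simp

/-- Weierstrass division: if `z` satisfies a regular power series equation over `k⟦y⟧`, then
`k⟦z, y⟧` is integral over `k⟦y⟧`. -/
theorem PowerSeries.isIntegralElem_substPi_cons {n : ℕ} (z : PowerSeries L)
    (hz : constantCoeff z = 0) (y : Fin n → PowerSeries L) (hy : ∀ i, constantCoeff (y i) = 0)
    (G : MvPowerSeries (Fin (n + 1)) k)
    (hG : substPi k (Fin.cons z y) (Fin.cases (by simpa) (by simpa)) G = 0)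
    (hG' : substPi k (Fin.cons X (fun _ => 0) : Fin (n + 1) → PowerSeries k)
      (Fin.cases (by simp) (by simp)) G ≠ 0)
    (h : MvPowerSeries (Fin (n + 1)) k) :
    (substPi k y hy : MvPowerSeries (Fin n) k →+* PowerSeries L).IsIntegralElem
      (substPi k (Fin.cons z y) (Fin.cases (by simpa) (by simpa)) h) := by
  let A := MvPowerSeries (Fin n) k
  let e := MvPowerSeries.finSuccEquiv k n
  let φ : A →+* PowerSeries L := substPi k y hy
  have : IsAdicComplete (IsLocalRing.maximalIdeal A) A :=
    MvPowerSeries.span_range_X_eq_maximalIdeal (k := k) (Fin n) ▸ inferInstance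
  have hreg : (e G).map (IsLocalRing.residue A) ≠ 0 := by
    intro h0
    refine hG' (PowerSeries.ext fun s => ?_)
    rw [coeff_substPi_cons_X_zero]
    have h1 : IsLocalRing.residue A (coeff s (e G)) = 0 := by
      rw [← PowerSeries.coeff_map, h0, map_zero]
    rw [IsLocalRing.residue_eq_zero_iff, IsLocalRing.mem_maximalIdeal, mem_nonunits_iff,
      MvPowerSeries.isUnit_iff_constantCoeff, isUnit_iff_ne_zero, not_not] at h1
    rw [h1, map_zero]
  -- In `F = G * q + r` the multiple of `G` goes to zero, leaving a polynomial in `z`. Dividing a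
  -- power of `z` then yields a monic equation for `z`.
  have hdiv : ∀ F : PowerSeries A, ∃ r : Polynomial A,
      r.degree < ((e G).map (Ideal.Quotient.mk (IsLocalRing.maximalIdeal A))).order.toNat ∧
      substPi k (Fin.cons z y) (Fin.cases (by simpa) (by simpa)) (e.symm F) =
        r.eval₂ φ z := by
    intro F
    obtain ⟨q, r, hr, hF⟩ := exists_isWeierstrassDivision F hreg
    refine ⟨r, hr, ?_⟩
    rw [hF, map_add, map_mul, AlgEquiv.symm_apply_apply, map_add, map_mul, hG, zero_mul, zero_add]
    exact substPi_finSuccEquiv_symm_coe z hz y hy r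
  have hzint : φ.IsIntegralElem z := by
    obtain ⟨r, hr, hr'⟩ := hdiv (X ^ ((e G).map
      (Ideal.Quotient.mk (IsLocalRing.maximalIdeal A))).order.toNat)
    refine ⟨_, Polynomial.monic_X_pow_sub (p := r) hr, ?_⟩
    have := substPi_finSuccEquiv_symm_coe (k := k) z hz y hy (Polynomial.X ^ ((e G).map
      (Ideal.Quotient.mk (IsLocalRing.maximalIdeal A))).order.toNat)
    rw [Polynomial.coe_pow, Polynomial.coe_X] at this
    rw [Polynomial.eval₂_sub, ← this, ← hr']
    exact sub_self _
  obtain ⟨r, -, hr⟩ := hdiv (e h)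
  rw [AlgEquiv.symm_apply_apply] at hr
  rw [hr]
  let := φ.toAlgebra
  have hz' : IsIntegral A z := hzint
  exact IsIntegral.of_mem_of_fg _ hz'.fg_adjoin_singleton _
    (Polynomial.aeval_mem_adjoin_singleton A z (p := r))

/-- Transitivity of integrality, through the integral closure of `A` in `B`. -/
theorem RingHom.IsIntegralElem.of_forall {A A' B : Type*} [CommRing A] [CommRing A'] [CommRing B]
    {φ : A →+* B} {ψ : A' →+* B} (h : ∀ a, φ.IsIntegralElem (ψ a)) {b : B}
    (hb : ψ.IsIntegralElem b) : φ.IsIntegralElem b := by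
  let := φ.toAlgebra
  let ψ' : A' →+* integralClosure A B := ψ.codRestrict _ h
  obtain ⟨p, hp, hpb⟩ := hb
  have : _root_.IsIntegral (integralClosure A B) b := by
    refine ⟨p.map ψ', hp.map _, ?_⟩
    rw [Polynomial.eval₂_map]
    exact hpb
  exact isIntegral_trans b this

theorem PowerSeries.substPi_injective_of_isEmpty {σ : Type*} [Finite σ] [IsEmpty σ]
    (j : σ → PowerSeries L) (hj : ∀ i, constantCoeff (j i) = 0) :
    Function.Injective (substPi k j hj) := by
  let e := (MvPowerSeries.isEmptyEquiv (σ := σ) (R := k)).symm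
  have h : Function.Injective ((substPi k j hj).comp e.toAlgHom) := RingHom.injective _
  exact (Function.Injective.of_comp_iff' _ e.bijective).1 h

/-- Formal Noether normalization for the ring `k⟦j₁, …, jₙ⟧`, by linear forms. -/
theorem PowerSeries.exists_normalization [Infinite k] {n : ℕ} (j : Fin n → PowerSeries L)
    (hj : ∀ i, constantCoeff (j i) = 0) :
    ∃ (e : ℕ) (y : Fin e → PowerSeries L) (hy : ∀ i, constantCoeff (y i) = 0),
      (∀ i, y i ∈ Submodule.span k (Set.range j)) ∧ Function.Injective (substPi k y hy) ∧
      ∀ f, (substPi k y hy : MvPowerSeries (Fin e) k →+* PowerSeries L).IsIntegralElem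
        (substPi k j hj f) := by
  induction n with
  | zero =>
    exact ⟨0, j, hj, fun i => i.elim0, substPi_injective_of_isEmpty j hj,
      fun f => RingHom.isIntegralElem_map _⟩
  | succ n ih =>
    by_cases hinj : Function.Injective (substPi k j hj)
    · exact ⟨n + 1, j, hj, fun i => Submodule.subset_span ⟨i, rfl⟩, hinj,
        fun f => RingHom.isIntegralElem_map _⟩
    obtain ⟨f, hf, hf0⟩ : ∃ f, substPi k j hj f = 0 ∧ f ≠ 0 := by
      simpa [injective_iff_map_eq_zero] using hinj
    obtain ⟨b, hb, hbf⟩ := MvPowerSeries.exists_substPi_line_ne_zero hf0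
    -- This shear turns the line of direction `b` into the first axis, where `f` becomes regular;
    -- `l` expresses the old coordinates in the new ones.
    let j' : Fin n → PowerSeries L := fun i => j i.succ - b i.succ • j 0
    have hj' : ∀ i, constantCoeff (j' i) = 0 := fun i => by simp [j', hj]
    let l : Fin (n + 1) → MvPowerSeries (Fin (n + 1)) k := Fin.cons (MvPowerSeries.X 0)
      fun i => MvPowerSeries.X i.succ + b i.succ • MvPowerSeries.X 0
    have hl : ∀ i, MvPowerSeries.constantCoeff (l i) = 0 :=
      Fin.cases (by simp [l]) fun i => by simp [l]
    have hl1 : ∀ g, substPi k (Fin.cons (j 0) j') (Fin.cases (by simp [hj]) (by simpa using hj'))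
        (MvPowerSeries.subst l g) = substPi k j hj g := fun g =>
      substPi_subst _ _ l hl j hj (Fin.cases (by simp [l]) fun i => by simp [l, j']) g
    have hl2 : substPi k (Fin.cons X (fun _ => 0) : Fin (n + 1) → PowerSeries k)
        (Fin.cases (by simp) (by simp)) (MvPowerSeries.subst l f) ≠ 0 := by
      rw [substPi_subst _ _ l hl (fun i => C (b i) * X) (by simp)
        (Fin.cases (by simp [l, hb]) fun i => by simp [l, PowerSeries.smul_eq_C_mul]) f]
      exact hbf
    have hint : ∀ g, (substPi k j' hj' : MvPowerSeries (Fin n) k →+* PowerSeries L).IsIntegralElem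
        (substPi k j hj g) := fun g => by
      have := isIntegralElem_substPi_cons (j 0) (hj 0) j' hj' (MvPowerSeries.subst l f)
        ((hl1 f).trans hf) hl2 (MvPowerSeries.subst l g)
      rwa [hl1] at this
    obtain ⟨e, y, hy, hspan, hyinj, hyint⟩ := ih j' hj'
    refine ⟨e, y, hy, fun i => ?_, hyinj, fun g => .of_forall hyint (hint g)⟩
    refine Submodule.span_le.2 ?_ (hspan i)
    rintro _ ⟨i, rfl⟩
    exact Submodule.sub_mem _ (Submodule.subset_span ⟨_, rfl⟩)
      (Submodule.smul_mem _ _ (Submodule.subset_span ⟨_, rfl⟩))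

end Normalization

/-! ### Going up and the lower bound on Krull dimension -/

section Chain

open PowerSeries

variable {k : Type*} [Field k]

/-- The prime ideal of `k⟦Y₀, …⟧` generated by the variables of index less than `i`. -/
noncomputable def MvPowerSeries.initialIdeal (k : Type*) [Field k] (e i : ℕ) :
    Ideal (MvPowerSeries (Fin e) k) :=
  RingHom.ker (substAlgHom (R := k) (hasSubst_of_constantCoeff_zero
    (a := fun l : Fin e => if (l : ℕ) < i then (0 : MvPowerSeries (Fin e) k) else X l)
    fun l => by split_ifs <;> simp))

instance (e i : ℕ) : (MvPowerSeries.initialIdeal k e i).IsPrime :=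
  have : IsDomain (MvPowerSeries (Fin e) k) := NoZeroDivisors.to_isDomain _
  RingHom.ker_isPrime _

theorem MvPowerSeries.X_mem_initialIdeal {e i : ℕ} {l : Fin e} :
    X l ∈ initialIdeal k e i ↔ (l : ℕ) < i := by
  rw [initialIdeal, RingHom.mem_ker, substAlgHom_X]
  split_ifs with h
  · simpa using h
  · refine iff_of_false (fun h0 => ?_) h
    have := congrArg (coeff (Finsupp.single l 1)) h0
    classical simp [coeff_X] at this

theorem MvPowerSeries.initialIdeal_zero (e : ℕ) : initialIdeal k e 0 = ⊥ := by
  rw [initialIdeal, ← RingHom.injective_iff_ker_eq_bot]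
  intro f g h
  simpa [substAlgHom_apply, subst_self] using h

/-- Killing `i + 1` variables factors through killing the first `i`. -/
theorem MvPowerSeries.initialIdeal_mono (e i : ℕ) :
    initialIdeal k e i ≤ initialIdeal k e (i + 1) := by
  intro f hf
  rw [initialIdeal, RingHom.mem_ker, substAlgHom_apply] at hf ⊢
  have h := congrArg (subst (S := k) (fun l : Fin e =>
    if (l : ℕ) < i + 1 then (0 : MvPowerSeries (Fin e) k) else X l)) hf
  have h1 : HasSubst (fun l : Fin e =>
      if (l : ℕ) < i + 1 then (0 : MvPowerSeries (Fin e) k) else X l) :=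
    hasSubst_of_constantCoeff_zero fun l => by split_ifs <;> simp
  rw [subst_comp_subst_apply (hasSubst_of_constantCoeff_zero fun l => by split_ifs <;> simp) h1,
    ← substAlgHom_apply h1 0, map_zero] at h
  refine Eq.trans (congrArg (fun a => subst a f) (funext fun l => ?_)) h
  by_cases hl : (l : ℕ) < i
  · rw [if_pos hl, if_pos (by omega), ← substAlgHom_apply h1, map_zero]
  · rw [if_neg hl, subst_X h1]

variable {L : Type*} [Field L] [Algebra k L]

/-- If `k⟦y₁, …, yₑ⟧` is a formal power series ring over which the image of a ring is integral,
and the `yᵢ` belong to this image, then the dimension of the ring is at least `e`. -/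
theorem PowerSeries.natCast_le_ringKrullDim {R : Type*} [CommRing R] (φ : R →+* PowerSeries L)
    {e : ℕ} (y : Fin e → PowerSeries L) (hy : ∀ i, constantCoeff (y i) = 0)
    (hinj : Function.Injective (substPi k y hy)) (hyφ : ∀ i, ∃ r, φ r = y i)
    (hint : ∀ r, (substPi k y hy : MvPowerSeries (Fin e) k →+* PowerSeries L).IsIntegralElem
      (φ r)) : (e : WithBot ℕ∞) ≤ ringKrullDim R := by
  let A := MvPowerSeries (Fin e) k
  let : Algebra A (PowerSeries L) :=
    (substPi k y hy : MvPowerSeries (Fin e) k →+* PowerSeries L).toAlgebra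
  let C := integralClosure A (PowerSeries L)
  let φ' : R →+* C := φ.codRestrict _ hint
  have hA : Function.Injective (algebraMap A C) := fun f g h => hinj (congrArg Subtype.val h)
  -- The chain of initial ideals is lifted to `C` by going up, then contracted to `R`.
  let P : ℕ → Ideal C → Prop := fun i Q =>
    Q.IsPrime ∧ Q.comap (algebraMap A C) = MvPowerSeries.initialIdeal k e i
  have start : ∃ Q, P 0 Q := by
    obtain ⟨Q, -, h⟩ := Ideal.exists_ideal_over_prime_of_isIntegral
      (MvPowerSeries.initialIdeal k e 0) (⊥ : Ideal C) (by
        rw [MvPowerSeries.initialIdeal_zero]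
        exact ((RingHom.injective_iff_ker_eq_bot _).1 hA).le)
    exact ⟨Q, h⟩
  have step : ∀ i (Q : {Q // P i Q}), ∃ Q' : {Q // P (i + 1) Q}, Q.1 ≤ Q'.1 := by
    rintro i ⟨Q, hQ, hQi⟩
    obtain ⟨Q', hle, h⟩ := Ideal.exists_ideal_over_prime_of_isIntegral
      (MvPowerSeries.initialIdeal k e (i + 1)) Q
      (hQi.trans_le (MvPowerSeries.initialIdeal_mono e i))
    exact ⟨⟨Q', h⟩, hle⟩
  obtain ⟨Q₀, hQ₀⟩ := start
  choose F hF using step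
  let Q : ∀ i, {Q // P i Q} := fun i => Nat.rec ⟨Q₀, hQ₀⟩ (fun i q => F i q) i
  have hQ : ∀ i, (Q i).1 ≤ (Q (i + 1)).1 := fun i => hF i (Q i)
  let q : Fin (e + 1) → PrimeSpectrum R := fun i =>
    ⟨(Q i).1.comap φ', (Q i).2.1.comap φ'⟩
  have hq : StrictMono q := by
    refine Fin.strictMono_iff_lt_succ.2 fun i => ?_
    refine lt_of_le_of_ne (Ideal.comap_mono (hQ i)) fun h => ?_
    -- A preimage of `y i` enters the chain exactly at stage `i + 1`, so the contracted inclusions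
    -- stay strict.
    obtain ⟨r, hr⟩ := hyφ i
    have hr' : φ' r = algebraMap A C (MvPowerSeries.X i) :=
      Subtype.ext (hr.trans (substPi_X y hy i).symm)
    have hmem : ∀ m : ℕ, φ' r ∈ (Q m).1 ↔ (i : ℕ) < m := fun m => by
      rw [hr', ← Ideal.mem_comap, (Q m).2.2, MvPowerSeries.X_mem_initialIdeal]
    have h1 : r ∈ (q i.castSucc).asIdeal ↔ r ∈ (q i.succ).asIdeal := by rw [h]
    have h2 : (i : ℕ) < i ↔ (i : ℕ) < i + 1 := (hmem i).symm.trans (h1.trans (hmem (i + 1)))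
    omega
  exact Order.LTSeries.length_le_krullDim (LTSeries.mk e q hq)

end Chain

/-! ### Affine dimension and independent polynomials -/

section Dimension

/-- The dimension of a nonempty affine set is bounded by the size of some family of polynomials
that is algebraically independent on the set. -/
theorem JetGerm.exists_zariskiDim_le {σ : Type*} [Finite σ] {S : Set (σ → ℂ)}
    (hS : S.Nonempty) :
    ∃ (r : ℕ) (f : Fin r → MvPolynomial σ ℂ),
      (∀ G : MvPolynomial (Fin r) ℂ, G ≠ 0 →
        ∃ x ∈ S, MvPolynomial.eval x (MvPolynomial.aeval f G) ≠ 0) ∧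
      JetGerm.zariskiDim S ≤ (r : WithBot ℕ∞) := by
  set J := MvPolynomial.vanishingIdeal ℂ S
  have : Algebra.FiniteType ℂ (MvPolynomial σ ℂ ⧸ J) := inferInstance
  have : Nontrivial (MvPolynomial σ ℂ ⧸ J) := by
    refine Ideal.Quotient.nontrivial_iff.2 fun h => ?_
    obtain ⟨x, hx⟩ := hS
    have h1 : (1 : MvPolynomial σ ℂ) ∈ J := h ▸ Submodule.mem_top
    simpa using (MvPolynomial.mem_vanishingIdeal_iff.1 h1) x hx
  obtain ⟨r, g, hg, hgi⟩ := exists_integral_inj_algHom_of_fg ℂ (MvPolynomial σ ℂ ⧸ J)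
  choose f hf using fun i => Ideal.Quotient.mk_surjective (I := J) (g (MvPolynomial.X i))
  have hfg : ∀ G, Ideal.Quotient.mk J (MvPolynomial.aeval f G) = g G := by
    intro G
    have : (Ideal.Quotient.mkₐ ℂ J).comp (MvPolynomial.aeval f) = g := by
      ext i
      simp [hf]
    exact DFunLike.congr_fun this G
  refine ⟨r, f, fun G hG => ?_, ?_⟩
  · by_contra! hS'
    refine hG (hg ?_)
    rw [map_zero, ← hfg, Ideal.Quotient.eq_zero_iff_mem, MvPolynomial.mem_vanishingIdeal_iff]
    intro x hx
    simpa [MvPolynomial.aeval_eq_eval] using hS' x hx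
  -- By incomparability, contraction of primes along an integral extension is strictly monotone.
  have hdim : JetGerm.zariskiDim S ≤ ringKrullDim (MvPolynomial (Fin r) ℂ) := by
    let := (g : MvPolynomial (Fin r) ℂ →+* MvPolynomial σ ℂ ⧸ J).toAlgebra
    have : Algebra.IsIntegral (MvPolynomial (Fin r) ℂ) (MvPolynomial σ ℂ ⧸ J) := ⟨hgi⟩
    refine Order.krullDim_le_of_strictMono (PrimeSpectrum.comap
      (algebraMap (MvPolynomial (Fin r) ℂ) (MvPolynomial σ ℂ ⧸ J))) fun p q hpq => ?_
    exact Ideal.IsIntegral.comap_lt_comap hpq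
  rw [MvPolynomial.ringKrullDim_of_isNoetherianRing, ringKrullDim_eq_zero_of_field, zero_add,
    Nat.card_eq_fintype_card, Fintype.card_fin] at hdim
  exact hdim

end Dimension

/-! ### Generic curves and parameter counts -/

namespace JetGerm

open PowerSeries

/-- A generic member of a set of curves, over an extension field of `ℂ`. -/
theorem exists_generic_curve {n k r : ℕ} (T : Set (FormalCurve n))
    (f : Fin r → MvPolynomial (Fin n × Fin (k + 1)) ℂ)
    (hf : ∀ G : MvPolynomial (Fin r) ℂ, G ≠ 0 →
      ∃ x ∈ truncate k '' T, MvPolynomial.eval x (MvPolynomial.aeval f G) ≠ 0) :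
    ∃ (L : Type) (_ : Field L) (_ : Algebra ℂ L) (j : Fin n → PowerSeries L)
      (hj : ∀ i, constantCoeff (j i) = 0),
      (∀ i s, (∀ a ∈ T, coeff s (a.1 i) = 0) → coeff s (j i) = 0) ∧
      (∀ h, (∀ a ∈ T, substPi ℂ a.1 a.2 h = 0) → substPi ℂ j hj h = 0) ∧
      AlgebraicIndependent ℂ fun b =>
        MvPolynomial.aeval (fun p : Fin n × Fin (k + 1) => coeff p.2 (j p.1)) (f b) := by
  -- `u` is the tautological curve over the ring of all functions on `T`. An equation valid on every
  -- member of `T` holds for `u`, hence over every quotient of `A`.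
  let A := T → ℂ
  let u : Fin n → PowerSeries A := fun i => PowerSeries.mk fun s a => coeff s (a.1.1 i)
  have hu : ∀ i, constantCoeff (u i) = 0 := fun i => by
    rw [← coeff_zero_eq_constantCoeff_apply, coeff_mk]
    funext a
    exact (coeff_zero_eq_constantCoeff_apply _).trans (a.1.2 i)
  let c : Fin n × Fin (k + 1) → A := fun p => coeff p.2 (u p.1)
  let Θ : MvPolynomial (Fin r) ℂ →ₐ[ℂ] A :=
    (MvPolynomial.aeval c).comp (MvPolynomial.aeval f)
  have hΘ : ∀ G a, Θ G a = MvPolynomial.eval (truncate k a.1) (MvPolynomial.aeval f G) := by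
    intro G a
    have : (Pi.evalAlgHom ℂ (fun _ : T => ℂ) a).comp (MvPolynomial.aeval c) =
        MvPolynomial.aeval (truncate k a.1) := by
      ext p
      simp [c, u, truncate]
    have h := DFunLike.congr_fun this (MvPolynomial.aeval f G)
    rwa [MvPolynomial.aeval_eq_eval] at h
  have hΘ0 : ∀ G, G ≠ 0 → Θ G ≠ 0 := by
    intro G hG h0
    obtain ⟨_, ⟨a, ha, rfl⟩, hx⟩ := hf G hG
    refine hx ?_
    rw [← hΘ G ⟨a, ha⟩, h0]
    rfl
  -- A prime avoiding all nonzero polynomials in the `f b` keeps them independent in the residue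
  -- field.
  obtain ⟨q, hq, -, hdisj⟩ := Ideal.exists_le_prime_disjoint (⊥ : Ideal A)
    ((nonZeroDivisors (MvPolynomial (Fin r) ℂ)).map (Θ : MvPolynomial (Fin r) ℂ →+* A)) (by
      rw [Set.disjoint_left]
      rintro _ h0 ⟨G, hG, rfl⟩
      exact hΘ0 G (nonZeroDivisors.ne_zero hG) h0)
  let L := FractionRing (A ⧸ q)
  let π : A →ₐ[ℂ] L := (IsScalarTower.toAlgHom ℂ (A ⧸ q) L).comp (Ideal.Quotient.mkₐ ℂ q)
  have hπ : ∀ x, π x = 0 → x ∈ q := fun x hx => by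
    rw [← Ideal.Quotient.eq_zero_iff_mem]
    exact (IsFractionRing.injective (A ⧸ q) L) (by simpa [π] using hx)
  have hj : ∀ i, constantCoeff (PowerSeries.map (π : A →+* L) (u i)) = 0 := fun i => by
    rw [← coeff_zero_eq_constantCoeff_apply, coeff_map, coeff_zero_eq_constantCoeff_apply, hu,
      map_zero]
  refine ⟨L, inferInstance, inferInstance, fun i => PowerSeries.map (π : A →+* L) (u i), hj,
    ?_, ?_, ?_⟩
  · intro i s h
    have : coeff s (u i) = 0 := by
      rw [coeff_mk]
      exact funext fun a => h a.1 a.2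
    rw [coeff_map, this, map_zero]
  · intro h hh
    have h0 : substPi ℂ u hu h = 0 := by
      ext s a
      have hmap : ∀ i, PowerSeries.map (Pi.evalAlgHom ℂ (fun _ : T => ℂ) a : A →+* ℂ) (u i) =
          a.1.1 i := fun i => by
        ext s
        simp only [coeff_map, u, coeff_mk]
        rfl
      have h1 := map_substPi (Pi.evalAlgHom ℂ (fun _ : T => ℂ) a) u hu
        (fun i => by rw [hmap]; exact a.1.2 i) h
      simp only [hmap] at h1
      rw [hh a.1 a.2] at h1
      exact congrArg (coeff s) h1
    rw [← map_substPi π u hu hj, h0, map_zero]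
  · rw [algebraicIndependent_iff]
    intro G hG
    by_contra hG0
    have h1 : π (Θ G) = 0 := by
      rw [← hG]
      have : (π.comp Θ) = MvPolynomial.aeval fun b => MvPolynomial.aeval
          (fun p : Fin n × Fin (k + 1) => coeff p.2 (PowerSeries.map (π : A →+* L) (u p.1)))
          (f b) := by
        ext b
        simp only [Θ, AlgHom.comp_apply, MvPolynomial.aeval_X]
        rw [← AlgHom.comp_apply, MvPolynomial.comp_aeval]
        simp [c]
      exact DFunLike.congr_fun this G
    exact Set.disjoint_left.1 hdisj (hπ _ h1)
      ⟨G, mem_nonZeroDivisors_of_ne_zero hG0, rfl⟩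

/-- The jets of order at most `k` of a generic curve of order at least `m` on a germ of dimension
`d` depend on at most `(k + 1 - m) * d` parameters. -/
theorem exists_le_ringKrullDim_of_algebraicIndependent {n k m r : ℕ} (hm : m ≤ k + 1)
    {L : Type*} [Field L] [Algebra ℂ L] (j : Fin n → PowerSeries L)
    (hj : ∀ i, constantCoeff (j i) = 0) (hjm : ∀ i s, s < m → coeff s (j i) = 0)
    (f : Fin r → MvPolynomial (Fin n × Fin (k + 1)) ℂ)
    (hf : AlgebraicIndependent ℂ fun b =>
        MvPolynomial.aeval (fun p : Fin n × Fin (k + 1) => coeff p.2 (j p.1)) (f b))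
    {R : Type*} [CommRing R] [Algebra ℂ R] (ι : R →ₐ[ℂ] MvPowerSeries (Fin n) ℂ)
    (hι : ∀ i, ∃ x, ι x = MvPowerSeries.X i) (I : Ideal R)
    (hI : ∀ h ∈ I, substPi ℂ j hj (ι h) = 0) :
    ∃ e : ℕ, (e : WithBot ℕ∞) ≤ ringKrullDim (R ⧸ I) ∧ r ≤ (k + 1 - m) * e := by
  classical
  have : CharZero L := charZero_of_injective_algebraMap (algebraMap ℂ L).injective
  have : CharZero (PowerSeries L) := charZero_of_injective_algebraMap
    (algebraMap L (PowerSeries L)).injective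
  obtain ⟨e, y, hy, hspan, hinj, hint⟩ := exists_normalization (k := ℂ) j hj
  refine ⟨e, ?_, ?_⟩
  · let φ : R →ₐ[ℂ] PowerSeries L := (substPi ℂ j hj).comp ι
    refine natCast_le_ringKrullDim (Ideal.Quotient.lift I (φ : R →+* PowerSeries L) hI) y hy
      hinj (fun i => ?_) fun x => ?_
    · have hle : Submodule.span ℂ (Set.range j) ≤ LinearMap.range φ.toLinearMap := by
        refine Submodule.span_le.2 ?_
        rintro _ ⟨l, rfl⟩
        obtain ⟨x, hx⟩ := hι l
        exact ⟨x, by simp [φ, hx]⟩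
      obtain ⟨x, hx⟩ := hle (hspan i)
      exact ⟨Ideal.Quotient.mk I x, hx⟩
    · obtain ⟨x, rfl⟩ := Ideal.Quotient.mk_surjective x
      exact hint (ι x)
  -- Derivations dual to the independent elements; `Φ` applies their combinations to `j`.
  · choose D hD using fun b : Fin r => hf.exists_derivation (Pi.single b (1 : L))
    let Δ : (Fin r → L) →ₗ[L] Derivation ℂ L L := Fintype.linearCombination L D
    have hΔ : ∀ c b, Δ c (MvPolynomial.aeval
        (fun p : Fin n × Fin (k + 1) => coeff p.2 (j p.1)) (f b)) = c b := fun c b => by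
      simp [Δ, Fintype.linearCombination_apply, Derivation.sum_apply, hD, Pi.single_apply]
    let Φ : (Fin r → L) →ₗ[L] Fin n → PowerSeries L :=
      { toFun := fun c i => (Δ c).mapPowerSeries (j i)
        map_add' := fun c c' => by ext; simp
        map_smul' := fun c c' => by ext; simp }
    have hΦ : ∀ c i s, coeff s (Φ c i) = Δ c (coeff s (j i)) := fun c i s =>
      Derivation.coeff_mapPowerSeries _ _ _
    have := finrank_le_mul_of_dependent Φ e m (k + 1 - m)
      (fun c i s hs => by rw [hΦ, hjm i s hs, map_zero])
      (fun c hc => by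
        funext b
        rw [← hΔ c b]
        have h0 : ∀ p : Fin n × Fin (k + 1), Δ c (coeff p.2 (j p.1)) = 0 := fun p => by
          rw [← hΦ]
          exact hc _ _ (by omega)
        induction f b using MvPolynomial.induction_on with
        | C a => simp
        | add p q hp hq => simp_all
        | mul_X p i hp => simp_all)
      (fun c => by
        -- There are `e + 1` vectors in a free module of rank `e`. The resulting combination `D'`
        -- kills `t` and `y`, hence `ℂ⟦y⟧` and, by integrality, every `j i`.
        have hdep : ¬ LinearIndependent (PowerSeries L) fun l (i : Fin e) =>
            (Δ (c l)).mapPowerSeries (y i) := fun h => by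
          have := h.fintype_card_le_finrank
          simp at this
        obtain ⟨g, hg, l, hl⟩ := Fintype.not_linearIndependent_iff.1 hdep
        refine ⟨g, fun h => hl (by rw [h]; rfl), fun i => ?_⟩
        let D' : Derivation ℂ (PowerSeries L) (PowerSeries L) :=
          ∑ l, g l • (Δ (c l)).mapPowerSeries
        have hD' : ∀ x, D' x = ∑ l, g l * (Δ (c l)).mapPowerSeries x := fun x => by
          simp [D', Derivation.sum_apply]
        have hy0 : ∀ h, D' (substPi ℂ y hy h) = 0 :=
          D'.substPi_eq_zero (by simp [hD', Derivation.mapPowerSeries_X]) y hy fun i => by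
            rw [hD']
            simpa using congrFun hg i
        have hj0 := D'.eq_zero_of_isIntegralElem _ hy0 (hint (MvPowerSeries.X i))
        rwa [substPi_X, hD'] at hj0)
    simpa using this

/-- The `k`-jets of order at least `m` of the curves on a germ of dimension `d` form a set of
dimension at most `(k + 1 - m) * d`. -/
theorem zariskiDim_image_truncate_le {n k m : ℕ} (hm : m ≤ k + 1) (T : Set (FormalCurve n))
    (hT : ∀ a ∈ T, ∀ i, ∀ s < m, coeff s (a.1 i) = 0)
    {R : Type*} [CommRing R] [Algebra ℂ R] (ι : R →ₐ[ℂ] MvPowerSeries (Fin n) ℂ)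
    (hι : ∀ i, ∃ x, ι x = MvPowerSeries.X i) (I : Ideal R)
    (hI : ∀ h ∈ I, ∀ a ∈ T, substPi ℂ a.1 a.2 (ι h) = 0) :
    zariskiDim (truncate k '' T) ≤ ((k + 1 - m : ℕ) : WithBot ℕ∞) * ringKrullDim (R ⧸ I) := by
  rcases (truncate k '' T).eq_empty_or_nonempty with hS | hS
  -- The empty set has dimension `⊥`.
  · have : Subsingleton (MvPolynomial (Fin n × Fin (k + 1)) ℂ ⧸
        MvPolynomial.vanishingIdeal ℂ (truncate k '' T)) := by
      rw [Ideal.Quotient.subsingleton_iff, hS, Ideal.eq_top_iff_one]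
      simp [MvPolynomial.mem_vanishingIdeal_iff]
    exact ringKrullDim_eq_bot_of_subsingleton.trans_le bot_le
  obtain ⟨r, f, hf, hdim⟩ := exists_zariskiDim_le hS
  obtain ⟨L, _, _, j, hj, hjm, hjI, hji⟩ := exists_generic_curve T f hf
  obtain ⟨e, he, hr⟩ := exists_le_ringKrullDim_of_algebraicIndependent hm j hj
    (fun i s hs => hjm i s fun a ha => hT a ha i s hs) f hji ι hι I
    fun h hh => hjI _ (hI h hh)
  refine hdim.trans ?_
  calc (r : WithBot ℕ∞) ≤ (((k + 1 - m) * e : ℕ) : WithBot ℕ∞) := by exact_mod_cast hr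
    _ = ((k + 1 - m : ℕ) : WithBot ℕ∞) * (e : WithBot ℕ∞) := by push_cast; rfl
    _ ≤ _ := by gcongr

end JetGerm

/-! ### Algebraic and analytic germs -/

namespace JetGerm

open PowerSeries

/-- The power series expansion of regular germs at the origin. -/
noncomputable def regularGermExpansion (n : ℕ) : RegularGerm n →ₐ[ℂ] MvPowerSeries (Fin n) ℂ :=
  IsLocalization.liftAlgHom (M := (originIdeal n).primeCompl)
    (f := MvPolynomial.coeToMvPowerSeries.algHom ℂ) (by
      rintro ⟨q, hq⟩
      refine MvPowerSeries.isUnit_iff_constantCoeff.2 (isUnit_iff_ne_zero.2 fun h => hq ?_)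
      refine RingHom.mem_ker.2 ?_
      simpa [← MvPowerSeries.coeff_zero_eq_constantCoeff_apply,
        MvPolynomial.constantCoeff_eq] using h)

theorem regularGermExpansion_algebraMap {n : ℕ} (p : MvPolynomial (Fin n) ℂ) :
    regularGermExpansion n (algebraMap _ _ p) = p := by
  simp [regularGermExpansion]

/-- Both homomorphisms agree on polynomials, hence on the localization. -/
theorem substPi_regularGermExpansion {n : ℕ} (j : FormalCurve n) (h : RegularGerm n) :
    substPi ℂ j.1 j.2 (regularGermExpansion n h) = compRegular j h := by
  have : ((substPi ℂ j.1 j.2).comp (regularGermExpansion n) : RegularGerm n →+* PowerSeries ℂ) =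
      compRegular j := by
    refine IsLocalization.ringHom_ext (originIdeal n).primeCompl (RingHom.ext fun p => ?_)
    simp [regularGermExpansion_algebraMap, compRegular]
  exact DFunLike.congr_fun this h

theorem X_mem_convergentSeries {n : ℕ} (i : Fin n) :
    (MvPowerSeries.X i : MvPowerSeries (Fin n) ℂ) ∈ ConvergentSeries n := by
  classical
  refine Eventually.of_forall fun x => ?_
  refine summable_of_ne_finset_zero (s := {Finsupp.single i 1}) fun d hd => ?_
  rw [Finset.mem_singleton] at hd
  simp [term, MvPowerSeries.coeff_X, hd]

/-- The bounds on the dimensions of spaces of jets, for any germ whose local ring maps to a quotient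
of the ring of formal power series. -/
theorem jets_dimension_le {n : ℕ} (A : Set (FormalCurve n)) (k : ℕ)
    {R : Type*} [CommRing R] [Algebra ℂ R] (ι : R →ₐ[ℂ] MvPowerSeries (Fin n) ℂ)
    (hι : ∀ i, ∃ x, ι x = MvPowerSeries.X i) (I : Ideal R)
    (hI : ∀ h ∈ I, ∀ a ∈ A, substPi ℂ a.1 a.2 (ι h) = 0) :
    (∀ m : ℕ, 1 ≤ m → m ≤ k → zariskiDim (jetsOfMultiplicity A k m) ≤
      ((k - m + 1 : ℕ) : WithBot ℕ∞) * ringKrullDim (R ⧸ I) +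
        ((min (m - 1) (k - m) : ℕ) : WithBot ℕ∞)) ∧
    zariskiDim (jets A k) ≤ (k : WithBot ℕ∞) * ringKrullDim (R ⧸ I) := by
  refine ⟨fun m _ hmk => ?_, ?_⟩
  · have hset : jetsOfMultiplicity A k m =
        truncate k '' {a ∈ A | HasMultiplicity (truncate k a) m} := by
      ext x
      constructor
      · rintro ⟨⟨a, ha, rfl⟩, hm⟩
        exact ⟨a, ⟨ha, hm⟩, rfl⟩
      · rintro ⟨a, ⟨ha, hm⟩, rfl⟩
        exact ⟨⟨a, ha, rfl⟩, hm⟩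
    have h := zariskiDim_image_truncate_le (k := k) (m := m) (by omega)
      {a ∈ A | HasMultiplicity (truncate k a) m} (fun a ha i s hs => by
        by_contra h0
        have : m ≤ s := ha.2.2 ⟨i, ⟨s, by omega⟩, rfl, h0⟩
        omega) ι hι I
      fun h hh a ha => hI h hh a ha.1
    rw [← hset, show k + 1 - m = k - m + 1 by omega] at h
    exact h.trans (le_add_of_nonneg_right (Nat.cast_nonneg _))
  -- Every curve through the origin has order at least 1, and `k + 1 - 1 = k`.
  · have h := zariskiDim_image_truncate_le (k := k) (m := 1) (by omega) A
      (fun a _ i s hs => by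
        obtain rfl : s = 0 := by omega
        exact (coeff_zero_eq_constantCoeff_apply _).trans (a.2 i)) ι hι I hI
    exact h

end JetGerm

theorem corollary4p5 (n : ℕ) (Y : Set (Fin n → ℂ)) (hY0 : (0 : Fin n → ℂ) ∈ Y) (k : ℕ) :
    (JetGerm.IsAlgebraicSet Y →
      (∀ m : ℕ, 1 ≤ m → m ≤ k →
        JetGerm.zariskiDim (JetGerm.jetsOfMultiplicity (JetGerm.algFormalJets Y) k m) ≤
          ((k - m + 1 : ℕ) : WithBot ℕ∞) * JetGerm.algGermDim Y +
            ((min (m - 1) (k - m) : ℕ) : WithBot ℕ∞)) ∧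
      JetGerm.zariskiDim (JetGerm.jets (JetGerm.algFormalJets Y) k) ≤
        (k : WithBot ℕ∞) * JetGerm.algGermDim Y) ∧
    (JetGerm.IsAnalyticSetGerm Y →
      (∀ m : ℕ, 1 ≤ m → m ≤ k →
        JetGerm.zariskiDim (JetGerm.jetsOfMultiplicity (JetGerm.analyticFormalJets Y) k m) ≤
          ((k - m + 1 : ℕ) : WithBot ℕ∞) * JetGerm.analyticGermDim Y +
            ((min (m - 1) (k - m) : ℕ) : WithBot ℕ∞)) ∧
      JetGerm.zariskiDim (JetGerm.jets (JetGerm.analyticFormalJets Y) k) ≤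
        (k : WithBot ℕ∞) * JetGerm.analyticGermDim Y) := by
  refine ⟨fun _ => ?_, fun _ => ?_⟩
  · refine JetGerm.jets_dimension_le (JetGerm.algFormalJets Y) k (JetGerm.regularGermExpansion n)
      (fun i => ⟨algebraMap (MvPolynomial (Fin n) ℂ)
        (JetGerm.RegularGerm n) (MvPolynomial.X i), ?_⟩) (JetGerm.regularIdeal Y)
      fun h hh a ha => ?_
    · rw [JetGerm.regularGermExpansion_algebraMap, MvPolynomial.coe_X]
    · rw [JetGerm.substPi_regularGermExpansion]
      exact ha h hh
  · refine JetGerm.jets_dimension_le (JetGerm.analyticFormalJets Y) k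
      (JetGerm.ConvergentSeries n).val (fun i => ⟨⟨_, JetGerm.X_mem_convergentSeries i⟩, rfl⟩)
      (JetGerm.analyticIdeal Y) fun h hh a ha => ?_
    rw [PowerSeries.substPi_apply]
    exact ha h hh
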